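/- For an integer $n\ge 0$ let $\hat G_n(x,z)$ be the modified Gegenbauer polynomial $$\hat G_n(x,z)=\sum_{k=0}^{\lfloor n/2\rfloor}(-1)^k\,\frac{\prod_{i=n-\lfloor n/2\rfloor}^{n-k-1}(z+i)\,\prod_{i=\lfloor n/2\rfloor}^{n-1}\left(z+\tfrac12+i\right)}{k!\,(n-2k)!}\,\frac{x^{n-2k}}{2^{2k}},$$ that is, the Jacobi polynomial $P_n^{(z-1/2,\,z-1/2)}(x)$; equivalently, it is the polynomial with $$2^n\prod_{i=0}^{n-1}\left(z+\tfrac i2\right)\hat G_n(x,z)=\prod_{i=0}^{n-1}\left(z+\tfrac12+i\right)G_n(x,z),\qquad G_n(x,z)=\sum_{k=0}^{\lfloor n/2\rfloor}(-1)^k\frac{\prod_{i=0}^{n-k-1}(z+i)}{k!\,(n-2k)!}(2x)^{n-2k}.$$ Let $p$ be a real polynomial of degree exactly $d$ and $q$ a real polynomial of degree exactly $d$ or $d-1$, all of whose roots are real; list the roots with multiplicity as $p_1\ge p_2\ge\dots\ge p_d$ and $q_1\ge q_2\ge\dots$. We say that $p$ interlaces $q$ if $p_1\ge q_1\ge p_2\ge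 q_2\ge\dots\ge p_{d-1}\ge q_{d-1}\ge p_d\ (\ge q_d)$, the last inequality being present only if $\deg q=d$, or if $\deg q=d$ and the same chain of inequalities holds with the roles of $p$ and $q$ exchanged. Then for every integer $n\ge 1$ and every $x\in[-1,0)\cup(0,1]$, the polynomial $z\mapsto\hat G_n(x,z)$ interlaces both $z\mapsto\hat G_{n-1}(x,z)$ and $z\mapsto\partial_x\hat G_n(x,z)$; in particular all three are nonzero and have only real roots in $z$. -/

import Mathlib

open Polynomial

noncomputable section

/-- The Gegenbauer polynomial `G_n(x, z)` as a bivariate polynomial: the outer variable of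
`ℝ[X][X]` is `x`, and the coefficients are polynomials in the parameter `z`
(written `X : ℝ[X]`). -/
def gegenbauer (n : ℕ) : ℝ[X][X] :=
  ∑ k ∈ Finset.range (n / 2 + 1),
    C (C ((-1 : ℝ) ^ k / ((k.factorial : ℝ) * ((n - 2 * k).factorial : ℝ))) *
        ∏ i ∈ Finset.range (n - k), (X + C (i : ℝ))) *
      (2 * X) ^ (n - 2 * k)

/-- The modified Gegenbauer polynomial `Ĝ_n(x, z)`, which is the Jacobi polynomial
`P_n^{(z - 1/2, z - 1/2)}(x)`, as a bivariate polynomial: the outer variable is `x`, and the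
coefficients are polynomials in `z`. -/
def modGegenbauer (n : ℕ) : ℝ[X][X] :=
  ∑ k ∈ Finset.range (n / 2 + 1),
    C (C ((-1 : ℝ) ^ k / ((k.factorial : ℝ) * ((n - 2 * k).factorial : ℝ) * 2 ^ (2 * k))) *
        ((∏ i ∈ Finset.Ico (n - n / 2) (n - k), (X + C (i : ℝ))) *
          ∏ i ∈ Finset.Ico (n / 2) n, (X + C (1 / 2 + (i : ℝ))))) *
      X ^ (n - 2 * k)

theorem prod_half_shift (n : ℕ) :
    (∏ i ∈ Finset.range n, (X + C ((i : ℝ) / 2)) : ℝ[X]) =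
      (∏ i ∈ Finset.range (n - n / 2), (X + C (i : ℝ))) *
        ∏ i ∈ Finset.range (n / 2), (X + C (1 / 2 + (i : ℝ))) := by
  induction n with
  | zero => simp
  | succ n ih =>
    rw [Finset.prod_range_succ, ih]
    obtain ⟨m, rfl | rfl⟩ := n.even_or_odd'
    · have h1 : 2 * m - 2 * m / 2 = m := by omega
      have h2 : 2 * m / 2 = m := by omega
      have h3 : (2 * m + 1) / 2 = m := by omega
      have h4 : 2 * m + 1 - m = m + 1 := by omega
      rw [h1, h2, h3, h4, Finset.prod_range_succ (fun i : ℕ => (X + C (i : ℝ) : ℝ[X]))]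
      have : ((2 * m : ℕ) : ℝ) / 2 = m := by push_cast; ring
      rw [this]; ring
    · have h2 : (2 * m + 1) / 2 = m := by omega
      have h1 : 2 * m + 1 - m = m + 1 := by omega
      have h3 : (2 * m + 1 + 1) / 2 = m + 1 := by omega
      have h4 : 2 * m + 1 + 1 - (m + 1) = m + 1 := by omega
      rw [h2, h1, h3, h4,
        Finset.prod_range_succ (fun i : ℕ => (X + C (1 / 2 + (i : ℝ)) : ℝ[X]))]
      have : ((2 * m + 1 : ℕ) : ℝ) / 2 = 1 / 2 + m := by push_cast; ring
      rw [this]; ring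

/-- The two families differ by the factor
`∏_{i<n} (z + 1/2 + i) / (2 ^ n ∏_{i<n} (z + i/2))`. -/
theorem modGegenbauer_mul (n : ℕ) :
    C (C ((2 : ℝ) ^ n) * ∏ i ∈ Finset.range n, (X + C ((i : ℝ) / 2))) * modGegenbauer n =
      C (∏ i ∈ Finset.range n, (X + C (1 / 2 + (i : ℝ)))) * gegenbauer n := by
  unfold modGegenbauer gegenbauer
  rw [Finset.mul_sum, Finset.mul_sum]
  refine Finset.sum_congr rfl fun k hk => ?_
  have hk : 2 * k ≤ n := by rw [Finset.mem_range] at hk; omega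
  have e2 : (2 * X : ℝ[X][X]) ^ (n - 2 * k) = C (C ((2 : ℝ) ^ (n - 2 * k))) * X ^ (n - 2 * k) := by
    rw [mul_pow]; simp only [map_pow]; rfl
  rw [e2, prod_half_shift,
    ← Finset.prod_range_mul_prod_Ico (fun i : ℕ => (X + C (i : ℝ) : ℝ[X]))
      (show n - n / 2 ≤ n - k by omega),
    ← Finset.prod_range_mul_prod_Ico (fun i : ℕ => (X + C (1 / 2 + (i : ℝ)) : ℝ[X]))
      (show n / 2 ≤ n by omega)]
  have e3 : (C ((-1 : ℝ) ^ k / ((k.factorial : ℝ) * ((n - 2 * k).factorial : ℝ))) : ℝ[X]) *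
      C ((2 : ℝ) ^ (n - 2 * k)) = C ((2 : ℝ) ^ n) *
      C ((-1 : ℝ) ^ k / ((k.factorial : ℝ) * ((n - 2 * k).factorial : ℝ) * 2 ^ (2 * k))) := by
    rw [← C_mul, ← C_mul]
    congr 1
    have h : (2 : ℝ) ^ n = 2 ^ (n - 2 * k) * 2 ^ (2 * k) := by
      rw [← pow_add]; congr 1; omega
    rw [h]
    field_simp
  have e4 := congrArg (C : ℝ[X] → ℝ[X][X]) e3
  simp only [C_mul] at e4 ⊢
  linear_combination (-(C (∏ i ∈ Finset.range (n - n / 2), (X + C (i : ℝ))) *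
    C (∏ i ∈ Finset.range (n / 2), (X + C (1 / 2 + (i : ℝ)))) *
    C (∏ i ∈ Finset.Ico (n - n / 2) (n - k), (X + C (i : ℝ))) *
    C (∏ i ∈ Finset.Ico (n / 2) n, (X + C (1 / 2 + (i : ℝ)))) * X ^ (n - 2 * k))) * e4

/-- `p` has degree exactly `n`, and `a 0 ≥ a 1 ≥ ⋯ ≥ a (n - 1)` are its roots, all real,
listed with multiplicity. -/
def IsRootSeq (p : ℝ[X]) {n : ℕ} (a : Fin n → ℝ) : Prop :=
  p.degree = n ∧ Antitone a ∧ p.roots = Finset.univ.val.map a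

/-- `p` is real-rooted of degree `n`, `q` is real-rooted of degree `n` or `n - 1`, and
`p_1 ≥ q_1 ≥ p_2 ≥ q_2 ≥ ⋯ ≥ p_{n-1} ≥ q_{n-1} ≥ p_n (≥ q_n)`. -/
def InterlacingChain (p q : ℝ[X]) : Prop :=
  ∃ (n m : ℕ) (a : Fin n → ℝ) (b : Fin m → ℝ),
    IsRootSeq p a ∧ IsRootSeq q b ∧ (m = n ∨ m + 1 = n) ∧
      (∀ (i : Fin n) (j : Fin m), (i : ℕ) = j → b j ≤ a i) ∧
      (∀ (i : Fin n) (j : Fin m), (i : ℕ) = j + 1 → a i ≤ b j)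

/-- `p` interlaces `q`, where `q` has the same degree as `p` or one less; for equal degrees
either polynomial may have the largest root. -/
def Interlaces (p q : ℝ[X]) : Prop :=
  InterlacingChain p q ∨ (p.degree = q.degree ∧ InterlacingChain q p)

end

/-! Write R_n for the factor of Ĝ_n left after removing its trivial roots -(1/2 + i), n/2 ≤ i < n.
Comparing coefficients expresses x R_{n+1}(t) through R_n(t) - (1 - x²) R_n(t + 1), with extra
linear factors when n is odd (`reducedGegenbauer_odd`, `reducedGegenbauer_even`).

Suppose 0 < x² < 1 and the roots z_j of Ĝ_n are more than 1 apart down to the first trivial one.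
Then the z_j and the z_j - 1 alternate strictly, and since 0 < 1 - x² < 1 the combination has one
root above the largest z_j and one in each interval (z_{j+1}, z_j - 1)
(`exists_roots_prod_sub_mul_prod`). The new roots z'_j thus satisfy z_j ≤ z'_j and z'_{j+1} ≤ z_j -
1. This reproduces the spacing, so the induction continues (`exists_succ`), and it contains both
interlacings: the roots of Ĝ_n lie in the gaps directly, those of ∂ₓĜ_{n+1} because ∂ₓĜ_{n+1}(x, t)
= (t + (n+1)/2) Ĝ_n(x, t + 1). For x² = 1 the shifted term disappears and the roots of R_n stay put.
-/

/-- The factor of `Ĝ_n(x, t)` left after removing `∏_{n/2 ≤ i < n} (t + 1/2 + i)`. -/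
noncomputable def reducedGegenbauer (n : ℕ) (x t : ℝ) : ℝ :=
  ∑ k ∈ Finset.range (n / 2 + 1),
    (-1 : ℝ) ^ k / ((k.factorial : ℝ) * ((n - 2 * k).factorial : ℝ) * 2 ^ (2 * k)) *
      (∏ i ∈ Finset.range (n / 2 - k), (t + ((n - n / 2 : ℕ) : ℝ) + i)) * x ^ (n - 2 * k)

theorem eval_modGegenbauer (n : ℕ) (x t : ℝ) :
    ((modGegenbauer n).eval (C x)).eval t =
      (∏ i ∈ Finset.Ico (n / 2) n, (t + (1 / 2 + (i : ℝ)))) * reducedGegenbauer n x t := by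
  unfold modGegenbauer reducedGegenbauer
  simp only [eval_finsetSum, eval_mul, eval_C, eval_pow, eval_X, eval_prod, eval_add,
    Finset.mul_sum]
  refine Finset.sum_congr rfl fun k hk => ?_
  have hk : k ≤ n / 2 := by rw [Finset.mem_range] at hk; omega
  rw [Finset.prod_Ico_eq_prod_range _ (n - n / 2) (n - k),
    show n - k - (n - n / 2) = n / 2 - k by omega]
  simp only [Nat.cast_add, add_assoc]
  ring

/-! ### Recurrences in the degree and the derivative formula -/

theorem reducedGegenbauer_odd (m : ℕ) (x t : ℝ) :
    (2 * m + 1 : ℝ) * x * reducedGegenbauer (2 * m + 1) x t =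
      reducedGegenbauer (2 * m) x t - (1 - x ^ 2) * reducedGegenbauer (2 * m) x (t + 1) := by
  unfold reducedGegenbauer
  simp only [show (2 * m + 1) / 2 = m by omega, show 2 * m / 2 = m by omega,
    show 2 * m + 1 - m = m + 1 by omega, show 2 * m - m = m by omega]
  -- By powers of x, term k + 1 on the left matches term k of R(t) - R(t + 1) and term k + 1 of x²
  -- R(t + 1). The leftover difference at k = m vanishes, its products being empty.
  rw [sub_mul, one_mul, ← sub_add, ← Finset.sum_sub_distrib, Finset.sum_range_succ' _ m,
    Finset.sum_range_succ (fun k => _ - _) m, Finset.sum_range_succ' _ m, mul_add, mul_add,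
    ← add_assoc, Finset.mul_sum, Finset.mul_sum]
  simp only [Nat.sub_self, Finset.prod_range_zero, sub_self, add_zero]
  rw [← Finset.sum_add_distrib]
  congr 1
  · refine Finset.sum_congr rfl fun k hk => ?_
    obtain ⟨l, rfl⟩ := Nat.exists_eq_add_of_lt (Finset.mem_range.mp hk)
    simp only [show k + l + 1 - k = l + 1 by omega, show k + l + 1 - (k + 1) = l by omega,
      show 2 * (k + l + 1) - 2 * k = 2 * l + 1 + 1 by omega,
      show 2 * (k + l + 1) - 2 * (k + 1) = 2 * l by omega,
      show 2 * (k + l + 1) + 1 - 2 * (k + 1) = 2 * l + 1 by omega, Nat.factorial_succ]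
    rw [Finset.prod_range_succ', Finset.prod_range_succ]
    have e : ∀ i : ℕ, t + 1 + ((k + l + 1 : ℕ) : ℝ) + i = t + ((k + l + 1 + 1 : ℕ) : ℝ) + i := by
      intro i; push_cast; ring
    have e' : ∀ i : ℕ, t + ((k + l + 1 : ℕ) : ℝ) + (i + 1 : ℕ) =
        t + ((k + l + 1 + 1 : ℕ) : ℝ) + i := by
      intro i; push_cast; ring
    simp only [e, e']
    generalize ∏ i ∈ Finset.range l, (t + ((k + l + 1 + 1 : ℕ) : ℝ) + i) = P
    push_cast
    field_simp
    ring
  · have e : ∀ i : ℕ, t + 1 + (m : ℝ) + i = t + ((m + 1 : ℕ) : ℝ) + i := by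
      intro i; push_cast; ring
    simp only [e]
    generalize ∏ i ∈ Finset.range (m - 0), (t + ((m + 1 : ℕ) : ℝ) + i) = P
    simp only [mul_zero, Nat.sub_zero, Nat.factorial_succ]
    push_cast
    field_simp
    ring

theorem reducedGegenbauer_even (m : ℕ) (x t : ℝ) :
    (2 * m + 2 : ℝ) * x * reducedGegenbauer (2 * m + 2) x t =
      (t + m + 1 / 2) * reducedGegenbauer (2 * m + 1) x t -
        (1 - x ^ 2) * ((t + m + 1) * reducedGegenbauer (2 * m + 1) x (t + 1)) := by
  unfold reducedGegenbauer
  simp only [show (2 * m + 2) / 2 = m + 1 by omega, show (2 * m + 1) / 2 = m by omega,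
    show 2 * m + 1 - m = m + 1 by omega, show 2 * m + 2 - (m + 1) = m + 1 by omega]
  rw [sub_mul, one_mul, ← sub_add, Finset.mul_sum _ _ (t + m + 1 / 2),
    Finset.mul_sum _ _ (t + m + 1), ← Finset.sum_sub_distrib, Finset.sum_range_succ' _ (m + 1),
    Finset.sum_range_succ _ m, Finset.sum_range_succ (fun k => _ - _) m,
    Finset.sum_range_succ' _ m, mul_add (_ * x), mul_add (_ * x), mul_add (x ^ 2),
    Finset.mul_sum _ _ (_ * x), Finset.mul_sum _ _ (x ^ 2),
    add_add_add_comm (Finset.sum _ _) _ (Finset.sum _ _), ← Finset.sum_add_distrib,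
    ← add_assoc (Finset.sum _ _)]
  congr 1
  · congr 1
    · refine Finset.sum_congr rfl fun k hk => ?_
      obtain ⟨l, rfl⟩ := Nat.exists_eq_add_of_lt (Finset.mem_range.mp hk)
      simp only [show k + l + 1 - k = l + 1 by omega, show k + l + 1 - (k + 1) = l by omega,
        show k + l + 1 + 1 - (k + 1) = l + 1 by omega,
        show 2 * (k + l + 1) + 1 - 2 * k = 2 * l + 1 + 1 + 1 by omega,
        show 2 * (k + l + 1) + 2 - 2 * (k + 1) = 2 * l + 1 + 1 by omega,
        show 2 * (k + l + 1) + 1 - 2 * (k + 1) = 2 * l + 1 by omega, Nat.factorial_succ]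
      rw [Finset.prod_range_succ', Finset.prod_range_succ]
      have e : ∀ i : ℕ, t + 1 + ((k + l + 1 + 1 : ℕ) : ℝ) + i =
          t + ((k + l + 1 + 1 + 1 : ℕ) : ℝ) + i := by
        intro i; push_cast; ring
      have e' : ∀ i : ℕ, t + ((k + l + 1 + 1 : ℕ) : ℝ) + (i + 1 : ℕ) =
          t + ((k + l + 1 + 1 + 1 : ℕ) : ℝ) + i := by
        intro i; push_cast; ring
      simp only [e, e']
      generalize ∏ i ∈ Finset.range l, (t + ((k + l + 1 + 1 + 1 : ℕ) : ℝ) + i) = P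
      push_cast
      field_simp
      ring
    -- Unlike in the odd case, the difference at k = m survives: (t + m + 1/2) - (t + m + 1) = -1/2
    -- supplies the term of R_{2m+2} constant in x.
    · simp only [Nat.sub_self, Finset.prod_range_zero,
        show 2 * m + 2 - 2 * (m + 1) = 0 by omega, show 2 * m + 1 - 2 * m = 1 by omega,
        Nat.factorial_succ]
      push_cast
      field_simp
      ring
  · have e : ∀ i : ℕ, t + 1 + ((m + 1 : ℕ) : ℝ) + i = t + ((m + 1 : ℕ) : ℝ) + (i + 1 : ℕ) := by
      intro i; push_cast; ring
    simp only [e, Nat.sub_zero]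
    rw [Finset.prod_range_succ']
    generalize ∏ i ∈ Finset.range m, (t + ((m + 1 : ℕ) : ℝ) + (i + 1 : ℕ)) = P
    simp only [mul_zero, Nat.sub_zero, Nat.factorial_succ]
    push_cast
    field_simp
    ring

/-- The shift t + 1 moves each product up by one index, so one lowest factor is missing: t + m + 1/2
from the half-integer product if n = 2m, t + m + 1 from the integer product if n = 2m + 1. Both
equal t + (n + 1)/2. -/
theorem eval_derivative_modGegenbauer (n : ℕ) (x t : ℝ) :
    ((derivative (modGegenbauer (n + 1))).eval (C x)).eval t =
      (t + (n + 1) / 2) * ((modGegenbauer n).eval (C x)).eval (t + 1) := by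
  unfold modGegenbauer
  simp only [derivative_sum, derivative_C_mul, derivative_X_pow, eval_finsetSum, eval_mul,
    eval_C, eval_pow, eval_X, eval_prod, eval_add, Finset.mul_sum, eval_natCast]
  obtain ⟨m, rfl | rfl⟩ := n.even_or_odd'
  · simp only [show (2 * m + 1) / 2 = m by omega, show 2 * m / 2 = m by omega,
      show 2 * m + 1 - m = m + 1 by omega, show 2 * m - m = m by omega]
    refine Finset.sum_congr rfl fun k hk => ?_
    obtain ⟨l, rfl⟩ := Nat.exists_eq_add_of_le (Finset.mem_range_succ_iff.mp hk)
    rw [Finset.prod_eq_prod_Ico_succ_bot (show k + l < 2 * (k + l) + 1 by omega)]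
    simp only [Finset.prod_Ico_eq_prod_range,
      show 2 * (k + l) + 1 - k - (k + l + 1) = l by omega,
      show 2 * (k + l) - k - (k + l) = l by omega,
      show 2 * (k + l) + 1 - (k + l + 1) = k + l by omega,
      show 2 * (k + l) - (k + l) = k + l by omega,
      show 2 * (k + l) + 1 - 2 * k = 2 * l + 1 by omega,
      show 2 * (k + l) - 2 * k = 2 * l by omega, Nat.factorial_succ, Nat.add_sub_cancel]
    have e : ∀ i : ℕ, t + 1 + ((k + l + i : ℕ) : ℝ) = t + ((k + l + 1 + i : ℕ) : ℝ) := by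
      intro i; push_cast; ring
    have e' : ∀ i : ℕ, t + 1 + (1 / 2 + ((k + l + i : ℕ) : ℝ)) =
        t + (1 / 2 + ((k + l + 1 + i : ℕ) : ℝ)) := by
      intro i; push_cast; ring
    simp only [e, e']
    generalize ∏ i ∈ Finset.range l, (t + ((k + l + 1 + i : ℕ) : ℝ)) = P
    generalize ∏ i ∈ Finset.range (k + l), (t + (1 / 2 + ((k + l + 1 + i : ℕ) : ℝ))) = Q
    push_cast
    field_simp
    ring
  · simp only [show (2 * m + 1 + 1) / 2 = m + 1 by omega, show (2 * m + 1) / 2 = m by omega,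
      show 2 * m + 1 + 1 - (m + 1) = m + 1 by omega, show 2 * m + 1 - m = m + 1 by omega]
    rw [Finset.sum_range_succ]
    simp only [show 2 * m + 1 + 1 - 2 * (m + 1) = 0 by omega, Nat.cast_zero, mul_zero, zero_mul,
      add_zero]
    refine Finset.sum_congr rfl fun k hk => ?_
    obtain ⟨l, rfl⟩ := Nat.exists_eq_add_of_le (Finset.mem_range_succ_iff.mp hk)
    rw [Finset.prod_eq_prod_Ico_succ_bot (show k + l + 1 < 2 * (k + l) + 1 + 1 - k by omega)]
    simp only [Finset.prod_Ico_eq_prod_range,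
      show 2 * (k + l) + 1 + 1 - k - (k + l + 1 + 1) = l by omega,
      show 2 * (k + l) + 1 - k - (k + l + 1) = l by omega,
      show 2 * (k + l) + 1 + 1 - (k + l + 1) = k + l + 1 by omega,
      show 2 * (k + l) + 1 - (k + l) = k + l + 1 by omega,
      show 2 * (k + l) + 1 + 1 - 2 * k = 2 * l + 1 + 1 by omega,
      show 2 * (k + l) + 1 - 2 * k = 2 * l + 1 by omega, Nat.add_sub_cancel,
      Nat.factorial_succ (2 * l + 1)]
    have e : ∀ i : ℕ, t + 1 + ((k + l + 1 + i : ℕ) : ℝ) = t + ((k + l + 1 + 1 + i : ℕ) : ℝ) := by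
      intro i; push_cast; ring
    have e' : ∀ i : ℕ, t + 1 + (1 / 2 + ((k + l + i : ℕ) : ℝ)) =
        t + (1 / 2 + ((k + l + 1 + i : ℕ) : ℝ)) := by
      intro i; push_cast; ring
    simp only [e, e']
    generalize ∏ i ∈ Finset.range l, (t + ((k + l + 1 + 1 + i : ℕ) : ℝ)) = P
    generalize ∏ i ∈ Finset.range (k + l + 1), (t + (1 / 2 + ((k + l + 1 + i : ℕ) : ℝ))) = Q
    push_cast
    field_simp
    ring

/-! ### Real roots of a combination of two interlacing products -/

theorem sign_prod_range_sub (u : ℝ) (s : ℕ → ℝ) {j M : ℕ} (hj : j ≤ M)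
    (hlt : ∀ i < j, u < s i) (hgt : ∀ i, j ≤ i → s i < u) :
    0 < (-1 : ℝ) ^ j * ∏ i ∈ Finset.range M, (u - s i) := by
  rw [← Finset.prod_range_mul_prod_Ico _ hj, ← mul_assoc]
  have e : (-1 : ℝ) ^ j * ∏ i ∈ Finset.range j, (u - s i) = ∏ i ∈ Finset.range j, (s i - u) := by
    rw [← Finset.card_range j, ← Finset.prod_const, Finset.card_range, ← Finset.prod_mul_distrib]
    exact Finset.prod_congr rfl fun i _ => by ring
  rw [e]
  exact mul_pos (Finset.prod_pos fun i hi => sub_pos.mpr (hlt i (Finset.mem_range.mp hi)))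
    (Finset.prod_pos fun i hi => sub_pos.mpr (hgt i (Finset.mem_Ico.mp hi).1))

/-- If `a_0 > b_0 > a_1 > b_1 > ⋯` and `0 < c < 1`, the polynomial
`∏ (t - a_j) - c ∏ (t - b_j)` is real-rooted, with roots in
`(a_0, ∞)`, `(a_1, b_0)`, `(a_2, b_1)`, …. -/
theorem exists_roots_prod_sub_mul_prod {a b : ℕ → ℝ} (hab : ∀ j, b j < a j)
    (hba : ∀ j, a (j + 1) < b j) {c : ℝ} (hc0 : 0 < c) (hc1 : c < 1) (M : ℕ) :
    ∃ r : ℕ → ℝ, (∀ t, ∏ j ∈ Finset.range M, (t - a j) - c * ∏ j ∈ Finset.range M, (t - b j) =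
        (1 - c) * ∏ j ∈ Finset.range M, (t - r j)) ∧
      (∀ j < M, a j < r j) ∧ ∀ j, j + 1 < M → r (j + 1) < b j := by
  have ha : StrictAnti a := strictAnti_nat_of_succ_lt fun j => (hba j).trans (hab j)
  have hb : StrictAnti b := strictAnti_nat_of_succ_lt fun j => (hab _).trans (hba j)
  let A : (ℕ → ℝ) → ℝ[X] := fun s => ∏ j ∈ Finset.range M, (X - C (s j))
  have hA : ∀ s, (A s).Monic := fun s => monic_prod_of_monic _ _ fun j _ => monic_X_sub_C _
  have hdeg : ∀ s, (A s).degree = M := fun s => by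
    simp [A, degree_prod]
  have hAe : ∀ s t, (A s).eval t = ∏ j ∈ Finset.range M, (t - s j) := fun s t => by
    simp [A, eval_prod]
  let P : ℝ[X] := A a - C c * A b
  have hPe : ∀ t, P.eval t =
      ∏ j ∈ Finset.range M, (t - a j) - c * ∏ j ∈ Finset.range M, (t - b j) := fun t => by
    simp only [P, eval_sub, eval_mul, eval_C, hAe]
  have hPa : ∀ j < M, (-1 : ℝ) ^ j * P.eval (a j) < 0 := by
    intro j hj
    have h := sign_prod_range_sub (a j) b hj.le (fun i hi => (ha.antitone hi).trans_lt (hba i))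
      (fun i hi => (hb.antitone hi).trans_lt (hab j))
    rw [hPe, Finset.prod_eq_zero (Finset.mem_range.mpr hj) (sub_self (a j))]
    nlinarith [mul_pos hc0 h]
  have hPb : ∀ j, j + 1 < M → 0 < (-1 : ℝ) ^ (j + 1) * P.eval (b j) := by
    intro j hj
    have h := sign_prod_range_sub (b j) a hj.le
      (fun i hi => (hab j).trans_le (ha.antitone (Nat.lt_succ_iff.mp hi)))
      (fun i hi => (ha.antitone hi).trans_lt (hba j))
    rw [hPe, Finset.prod_eq_zero (f := fun i => b j - b i)
      (Finset.mem_range.mpr (j.lt_succ_self.trans hj)) (sub_self (b j))]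
    simpa using h
  have hroot : ∀ j < M, ∃ r, a j < r ∧ (∀ i, i + 1 = j → r < b i) ∧ P.eval r = 0 := by
    intro j hj
    have key : ∀ u, a j < u → 0 < (-1 : ℝ) ^ j * P.eval u →
        ∃ r, a j < r ∧ r < u ∧ P.eval r = 0 := by
      intro u hu hpos
      have hcont : ContinuousOn (fun t => (-1 : ℝ) ^ j * P.eval t) (Set.Icc (a j) u) := by
        fun_prop
      obtain ⟨r, hr, hr0⟩ := intermediate_value_Ioo hu.le hcont ⟨hPa j hj, hpos⟩
      exact ⟨r, hr.1, hr.2, by simpa using hr0⟩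
    cases j with
    | zero =>
      -- No b bounds the first interval from above; the positive leading coefficient 1 - c makes P
      -- positive far to the right.
      have hlt : (C c * A b).degree ≤ (M : WithBot ℕ) := by
        rw [degree_C_mul hc0.ne', hdeg]
      have hcoeff : P.coeff M = 1 - c := by
        have h : ∀ s, (A s).coeff M = 1 := fun s => by
          have := (hA s).coeff_natDegree
          rwa [natDegree_eq_of_degree_eq_some (hdeg s)] at this
        simp only [P, coeff_sub, coeff_C_mul, h, mul_one]
      have hPle : P.degree ≤ (M : WithBot ℕ) :=
        (degree_sub_le _ _).trans (max_le (hdeg a).le hlt)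
      have hPdeg : P.degree = M :=
        le_antisymm hPle (le_degree_of_ne_zero (by rw [hcoeff]; linarith))
      have hlc : P.leadingCoeff = 1 - c := by
        rw [leadingCoeff, natDegree_eq_of_degree_eq_some hPdeg, hcoeff]
      have ht := P.tendsto_atTop_of_leadingCoeff_nonneg
        (by rw [hPdeg]; exact_mod_cast hj) (by rw [hlc]; linarith)
      obtain ⟨u, hu, hau⟩ :=
        ((ht.eventually_gt_atTop 0).and (Filter.eventually_gt_atTop (a 0))).exists
      obtain ⟨r, h1, -, h3⟩ := key u hau (by simpa using hu)
      exact ⟨r, h1, fun i hi => absurd hi (Nat.succ_ne_zero i), h3⟩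
    | succ j =>
      obtain ⟨r, h1, h2, h3⟩ := key (b j) (hba j) (hPb j hj)
      exact ⟨r, h1, fun i hi => by obtain rfl := Nat.succ_injective hi; exact h2, h3⟩
  choose! r hra hrb hr0 using hroot
  refine ⟨r, ?_, hra, fun j hj => hrb _ hj j rfl⟩
  have hanti : ∀ i j, i < j → j < M → r j < r i := by
    intro i j hij hj
    obtain ⟨k, rfl⟩ := Nat.exists_eq_add_of_lt hij
    calc r (i + k + 1) < b (i + k) := hrb _ hj _ rfl
      _ ≤ b i := hb.antitone (Nat.le_add_right i k)
      _ < a i := hab i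
      _ < r i := hra i (by omega)
  have hinj : Set.InjOn r (Finset.range M : Finset ℕ) := by
    intro i hi j hj hij
    have hi := Finset.mem_range.mp hi
    have hj := Finset.mem_range.mp hj
    by_contra hne
    rcases lt_or_gt_of_ne hne with h | h
    · exact (hanti i j h hj).ne' hij
    · exact (hanti j i h hi).ne hij
  have hsub : ∀ s s', (A s - A s').degree < (M : WithBot ℕ) := fun s s' => by
    rw [← hdeg s]
    exact degree_sub_lt_left ((hdeg s).trans (hdeg s').symm) (hA s).ne_zero
      ((hA s).trans (hA s').symm)
  -- The difference has degree below M, as the leading coefficients agree, and vanishes at M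
  -- distinct points.
  have hP : P = C (1 - c) * A r := by
    refine eq_of_degree_sub_lt_of_eval_finset_eq ((Finset.range M).image r) ?_ ?_
    · rw [Finset.card_image_of_injOn hinj, Finset.card_range,
        show P - C (1 - c) * A r = (A a - A r) - C c * (A b - A r) by
          simp only [P, C_sub, C_1]; ring]
      refine (degree_sub_le _ _).trans_lt (max_lt (hsub _ _) ?_)
      rw [degree_C_mul hc0.ne']
      exact hsub _ _
    · intro t ht
      obtain ⟨j, hj, rfl⟩ := Finset.mem_image.mp ht
      rw [hr0 j (Finset.mem_range.mp hj), eval_mul, hAe, Finset.prod_eq_zero hj (sub_self _),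
        mul_zero]
  intro t
  rw [← hPe, hP, eval_mul, eval_C, hAe]

/-! ### Induction on the degree: spacing of the roots -/

/-- `z` lists the roots of `Ĝ_n(x, ·)`, continued by `-(j + 1/2)` for `j ≥ n`: consecutive ones
are at distance at least one, and more than one for the first ones if `x ^ 2 < 1`. -/
structure IsGegenbauerRootSeq (n : ℕ) (x κ : ℝ) (z : ℕ → ℝ) : Prop where
  const_ne_zero : κ ≠ 0
  reduced_eq : ∀ t, reducedGegenbauer n x t = κ * ∏ j ∈ Finset.range (n / 2), (t - z j)
  eq_of_le : ∀ j, n / 2 ≤ j → z j = -(1 / 2 + (j : ℝ))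
  succ_le : ∀ j, z (j + 1) ≤ z j - 1
  succ_lt : x ^ 2 < 1 → ∀ j < n / 2, z (j + 1) < z j - 1

theorem isGegenbauerRootSeq_zero (x : ℝ) :
    IsGegenbauerRootSeq 0 x 1 fun j => -(1 / 2 + (j : ℝ)) where
  const_ne_zero := one_ne_zero
  reduced_eq t := by simp [reducedGegenbauer]
  eq_of_le _ _ := rfl
  succ_le j := by push_cast; linarith
  succ_lt _ j hj := by simp at hj

/-- The roots `z_j - 1` of `Ĝ_n(x, · + 1)`, together with interspersed auxiliary values. -/
noncomputable def shiftedRoot (n : ℕ) (z : ℕ → ℝ) (j : ℕ) : ℝ :=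
  if j < n / 2 then z j - 1 else z j - 1 / 2

namespace IsGegenbauerRootSeq

variable {n : ℕ} {x κ : ℝ} {z : ℕ → ℝ}

theorem antitone (h : IsGegenbauerRootSeq n x κ z) : Antitone z :=
  antitone_nat_of_succ_le fun j => by linarith [h.succ_le j]

theorem eval_eq (h : IsGegenbauerRootSeq n x κ z) (t : ℝ) :
    ((modGegenbauer n).eval (C x)).eval t = κ * ∏ j ∈ Finset.range n, (t - z j) := by
  rw [eval_modGegenbauer, h.reduced_eq,
    ← Finset.prod_range_mul_prod_Ico (fun j => t - z j) (Nat.div_le_self n 2)]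
  have e : ∏ j ∈ Finset.Ico (n / 2) n, (t - z j) =
      ∏ j ∈ Finset.Ico (n / 2) n, (t + (1 / 2 + (j : ℝ))) :=
    Finset.prod_congr rfl fun j hj => by rw [h.eq_of_le j (Finset.mem_Ico.mp hj).1, sub_neg_eq_add]
  rw [e]
  ring

/-- For odd n the recurrence carries the extra roots -(m + 1/2) and -(m + 1), with m = n/2 rounded
down. The first is the trivial root z_m, the second is z_m - 1/2, hence the 1/2 in `shiftedRoot`. -/
theorem reduced_succ (h : IsGegenbauerRootSeq n x κ z) (t : ℝ) :
    (n + 1 : ℝ) * x * reducedGegenbauer (n + 1) x t =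
      κ * (∏ j ∈ Finset.range ((n + 1) / 2), (t - z j) -
        (1 - x ^ 2) * ∏ j ∈ Finset.range ((n + 1) / 2), (t - shiftedRoot n z j)) := by
  have hG : reducedGegenbauer n x (t + 1) =
      κ * ∏ j ∈ Finset.range (n / 2), (t - shiftedRoot n z j) := by
    rw [h.reduced_eq]
    congr 1
    refine Finset.prod_congr rfl fun j hj => ?_
    rw [shiftedRoot, if_pos (Finset.mem_range.mp hj)]
    ring
  have hF := h.reduced_eq t
  have hz := h.eq_of_le (n / 2) le_rfl
  obtain ⟨m, rfl | rfl⟩ := n.even_or_odd'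
  · have := reducedGegenbauer_odd m x t
    rw [hF, hG] at this
    rw [show (2 * m + 1) / 2 = 2 * m / 2 by omega]
    push_cast
    rw [this]
    ring
  · have := reducedGegenbauer_even m x t
    rw [hF, hG] at this
    rw [show (2 * m + 1 + 1) / 2 = (2 * m + 1) / 2 + 1 by omega, Finset.prod_range_succ,
      Finset.prod_range_succ, hz, shiftedRoot, if_neg (lt_irrefl _), hz,
      show (2 * m + 1) / 2 = m by omega]
    rw [show (2 * m + 1) / 2 = m by omega] at this
    push_cast
    linear_combination this

theorem exists_succ (h : IsGegenbauerRootSeq n x κ z) (hx0 : x ≠ 0) (hx1 : x ^ 2 ≤ 1) :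
    ∃ κ' z', IsGegenbauerRootSeq (n + 1) x κ' z' ∧ (∀ j, z j ≤ z' j) ∧
      ∀ j, z' (j + 1) ≤ z j - 1 := by
  have hn : (n + 1 : ℝ) ≠ 0 := by positivity
  have hM : n / 2 ≤ (n + 1) / 2 := by omega
  have hM' : (n + 1) / 2 ≤ n / 2 + 1 := by omega
  have hred := h.reduced_succ
  set M := (n + 1) / 2 with hMdef
  -- The factor x² is 1 - c for c = 1 - x², the leading coefficient of the combination.
  have hκ : κ * x ^ 2 / ((n + 1) * x) ≠ 0 :=
    div_ne_zero (mul_ne_zero h.const_ne_zero (pow_ne_zero 2 hx0)) (mul_ne_zero hn hx0)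
  rcases hx1.lt_or_eq with hx | hx
  · have hstep : ∀ j, n / 2 ≤ j → z (j + 1) = z j - 1 := fun j hj => by
      rw [h.eq_of_le j hj, h.eq_of_le (j + 1) (by omega)]; push_cast; ring
    obtain ⟨r, hr, hzr, hrb⟩ := exists_roots_prod_sub_mul_prod (a := z) (b := shiftedRoot n z)
      (c := 1 - x ^ 2)
      (fun j => by unfold shiftedRoot; split_ifs <;> linarith)
      (fun j => by
        unfold shiftedRoot
        split_ifs with hj
        · exact h.succ_lt hx j hj
        · linarith [hstep j (not_lt.mp hj)])
      (by linarith) (by linarith [pow_pos (abs_pos.mpr hx0) 2, sq_abs x]) M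
    have hrz : ∀ j, j + 1 < M → r (j + 1) < z j - 1 := fun j hj => by
      have := hrb j hj
      rwa [shiftedRoot, if_pos (by omega)] at this
    have hgt : ∀ j, z j ≤ if j < M then r j else -(1 / 2 + (j : ℝ)) := fun j => by
      split_ifs with hj
      · exact (hzr j hj).le
      · exact (h.eq_of_le j (by omega)).le
    have hlt : ∀ j, (if j + 1 < M then r (j + 1) else -(1 / 2 + ((j + 1 : ℕ) : ℝ))) ≤ z j - 1 := by
      intro j
      split_ifs with hj
      · exact (hrz j hj).le
      · rw [← h.eq_of_le (j + 1) (by omega)]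
        exact h.succ_le j
    -- Strict spacing is inherited: z'_{j+1} ≤ z_j - 1 < z'_j - 1.
    have hlt' : ∀ j < M, (if j + 1 < M then r (j + 1) else -(1 / 2 + ((j + 1 : ℕ) : ℝ))) <
        (if j < M then r j else -(1 / 2 + (j : ℝ))) - 1 := by
      intro j hj
      rw [if_pos hj]
      linarith [hlt j, hzr j hj]
    refine ⟨κ * x ^ 2 / ((n + 1) * x), fun j => if j < M then r j else -(1 / 2 + (j : ℝ)),
      ⟨hκ, fun t => ?_, fun j hj => if_neg (not_lt.mpr hj), fun j => ?_, fun _ => hlt'⟩, hgt, hlt⟩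
    · have e : ∏ j ∈ Finset.range M, (t - if j < M then r j else -(1 / 2 + (j : ℝ))) =
          ∏ j ∈ Finset.range M, (t - r j) :=
        Finset.prod_congr rfl fun j hj => by rw [if_pos (Finset.mem_range.mp hj)]
      have := hred t
      rw [hr] at this
      rw [← hMdef, e, div_mul_eq_mul_div, eq_div_iff (mul_ne_zero hn hx0)]
      linear_combination this
    · exact (hlt j).trans (sub_le_sub_right (hgt j) 1)
  · refine ⟨κ * x ^ 2 / ((n + 1) * x), z, ⟨hκ, fun t => ?_, fun j hj => h.eq_of_le j (hM.trans hj),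
      h.succ_le, fun hlt => absurd hx hlt.ne⟩, fun _ => le_rfl, h.succ_le⟩
    have := hred t
    rw [hx, sub_self, zero_mul, sub_zero] at this
    rw [← hMdef, hx]
    field_simp
    linear_combination this

end IsGegenbauerRootSeq

theorem exists_isGegenbauerRootSeq {x : ℝ} (hx0 : x ≠ 0) (hx1 : x ^ 2 ≤ 1) (n : ℕ) :
    ∃ κ z, IsGegenbauerRootSeq n x κ z := by
  induction n with
  | zero => exact ⟨_, _, isGegenbauerRootSeq_zero x⟩
  | succ n ih =>
    obtain ⟨κ, z, h⟩ := ih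
    obtain ⟨κ', z', h', -⟩ := h.exists_succ hx0 hx1
    exact ⟨κ', z', h'⟩

/-! ### From root sequences to interlacing -/

theorem isRootSeq_of_eval_eq {p : ℝ[X]} {n : ℕ} {κ : ℝ} {z : ℕ → ℝ} (hκ : κ ≠ 0)
    (hz : Antitone z) (hp : ∀ t, p.eval t = κ * ∏ j ∈ Finset.range n, (t - z j)) :
    IsRootSeq p fun i : Fin n => z i := by
  have e : p = C κ * ∏ i : Fin n, (X - C (z i)) := by
    refine Polynomial.funext fun t => ?_
    rw [hp, ← Fin.prod_univ_eq_prod_range (fun j => t - z j)]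
    simp [eval_prod]
  refine ⟨?_, fun i j hij => hz hij, ?_⟩
  · rw [e, degree_C_mul hκ, degree_prod]
    simp
  · rw [e, roots_C_mul _ hκ]
    have := roots_multiset_prod_X_sub_C (Finset.univ.val.map fun i : Fin n => z i)
    rwa [Multiset.map_map] at this

theorem interlacingChain_of_eval_eq {p q : ℝ[X]} {n m : ℕ} {κ ν : ℝ} {a b : ℕ → ℝ} (hκ : κ ≠ 0)
    (hν : ν ≠ 0) (hp : ∀ t, p.eval t = κ * ∏ j ∈ Finset.range n, (t - a j))
    (hq : ∀ t, q.eval t = ν * ∏ j ∈ Finset.range m, (t - b j)) (hm : m = n ∨ m + 1 = n)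
    (hba : ∀ j, b j ≤ a j) (hab : ∀ j, a (j + 1) ≤ b j) : InterlacingChain p q := by
  have ha : Antitone a := antitone_nat_of_succ_le fun j => (hab j).trans (hba j)
  have hb : Antitone b := antitone_nat_of_succ_le fun j => (hba _).trans (hab j)
  refine ⟨n, m, _, _, isRootSeq_of_eval_eq hκ ha hp, isRootSeq_of_eval_eq hν hb hq, hm,
    fun i j hij => ?_, fun i j hij => ?_⟩
  · rw [hij]; exact hba j
  · rw [hij]; exact hab j

/-- The roots of `∂ₓ Ĝ_{n+1}(x, ·)`, in terms of those of `Ĝ_n(x, ·)`. -/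
noncomputable def derivativeRoot (n : ℕ) (z : ℕ → ℝ) (j : ℕ) : ℝ :=
  if j < n / 2 then z j - 1 else if j = n / 2 then -((n + 1) / 2) else z j

/-- A trivial root shifted by -1 is the next trivial root, so beyond index n/2 the list is z again,
moved by one place; the freed place holds the root -(n + 1)/2 of the linear factor. -/
theorem IsGegenbauerRootSeq.eval_derivative_eq {n : ℕ} {x κ : ℝ} {z : ℕ → ℝ}
    (h : IsGegenbauerRootSeq n x κ z) (t : ℝ) :
    ((derivative (modGegenbauer (n + 1))).eval (C x)).eval t =
      κ * ∏ j ∈ Finset.range (n + 1), (t - derivativeRoot n z j) := by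
  rw [eval_derivative_modGegenbauer, h.eval_eq,
    ← Finset.prod_range_mul_prod_Ico (fun j => t - derivativeRoot n z j)
      (show n / 2 ≤ n + 1 by omega),
    ← Finset.prod_range_mul_prod_Ico (fun j => t + 1 - z j) (Nat.div_le_self n 2),
    Finset.prod_eq_prod_Ico_succ_bot (show n / 2 < n + 1 by omega),
    ← Finset.prod_Ico_add' (fun j => t - derivativeRoot n z j) (n / 2) n 1]
  have e1 : ∏ j ∈ Finset.range (n / 2), (t - derivativeRoot n z j) =
      ∏ j ∈ Finset.range (n / 2), (t + 1 - z j) :=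
    Finset.prod_congr rfl fun j hj => by
      rw [derivativeRoot, if_pos (Finset.mem_range.mp hj)]; ring
  have e2 : ∏ j ∈ Finset.Ico (n / 2) n, (t - derivativeRoot n z (j + 1)) =
      ∏ j ∈ Finset.Ico (n / 2) n, (t + 1 - z j) :=
    Finset.prod_congr rfl fun j hj => by
      have hj := (Finset.mem_Ico.mp hj).1
      rw [derivativeRoot, if_neg (by omega), if_neg (by omega), h.eq_of_le j hj,
        h.eq_of_le (j + 1) (by omega)]
      push_cast
      ring
  rw [e1, e2, derivativeRoot, if_neg (lt_irrefl _), if_pos rfl]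
  ring

theorem mainTheorem4 (n : ℕ) (hn : 1 ≤ n) (x : ℝ)
    (hx : x ∈ Set.Ico (-1 : ℝ) 0 ∪ Set.Ioc (0 : ℝ) 1) :
    Interlaces ((modGegenbauer n).eval (C x)) ((modGegenbauer (n - 1)).eval (C x)) ∧
      Interlaces ((modGegenbauer n).eval (C x))
        ((derivative (modGegenbauer n)).eval (C x)) := by
  have hx0 : x ≠ 0 := by
    rcases hx with hx | hx
    · exact hx.2.ne
    · exact hx.1.ne'
  have hx1 : x ^ 2 ≤ 1 := by
    rw [sq_le_one_iff_abs_le_one, abs_le]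
    rcases hx with hx | hx
    · exact ⟨hx.1, by linarith [hx.2]⟩
    · exact ⟨by linarith [hx.1], hx.2⟩
  obtain ⟨n, rfl⟩ := Nat.exists_eq_add_of_le' hn
  obtain ⟨κ, z, h⟩ := exists_isGegenbauerRootSeq hx0 hx1 n
  obtain ⟨κ', z', h', hge, hle⟩ := h.exists_succ hx0 hx1
  refine ⟨.inl (interlacingChain_of_eval_eq h'.const_ne_zero h.const_ne_zero h'.eval_eq h.eval_eq
    (.inr rfl) hge fun j => (hle j).trans (by linarith)),
    .inl (interlacingChain_of_eval_eq h'.const_ne_zero h.const_ne_zero h'.eval_eq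
      h.eval_derivative_eq (.inl rfl) (fun j => ?_) fun j => ?_)⟩
  · refine le_trans ?_ (hge j)
    unfold derivativeRoot
    split_ifs with h1 h2
    · linarith
    -- The root -(n + 1)/2 is z_{n/2} for even n and z_{n/2} - 1/2 for odd n, so it lies between
    -- z_{n/2} - 1 and z_{n/2}; the parity bounds on n/2 here and below express this.
    · rw [h.eq_of_le j h2.ge, h2]
      have : 2 * ((n / 2 : ℕ) : ℝ) ≤ n := by exact_mod_cast Nat.mul_div_le n 2
      linarith
    · exact le_rfl
  · unfold derivativeRoot
    split_ifs with h1 h2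
    · exact hle j
    · refine (hle j).trans ?_
      rw [h.eq_of_le j h2.ge, h2]
      have : (n : ℝ) ≤ 2 * ((n / 2 : ℕ) : ℝ) + 1 := by
        exact_mod_cast (show n ≤ 2 * (n / 2) + 1 by omega)
      linarith
    · exact (hle j).trans (by linarith)
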